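/- Let $G$ be a finite simple graph. For an integer $k \ge 1$, the $k$-duplication of a vertex $v$ of $G$ replaces $v$ by $k$ mutually adjacent vertices, each having the same neighbourhood in $G - v$ as $v$. A (closed) blowup of $G$ is a graph obtained (up to isomorphism) by performing, for every vertex $v$ of $G$, a $k_v$-duplication of $v$, for some positive integers $k_v$. Equivalently, each vertex $v$ is replaced by a clique on $k_v$ vertices, and two vertices coming from distinct vertices $u, v$ of $G$ are adjacent if and only if $u$ and $v$ are adjacent in $G$. For a simple graph $H$ on $m$ vertices let $\mathcal{S}(H)$ be the set of all real symmetric $m \times m$ matrices $A = (a_{ij})$, indexed by the vertices of $H$, such that for $i \ne j$ one has $a_{ij} \ne 0$ if and only if $i$ and $j$ are adjacent in $H$; the diagonal entries are unrestricted. The spectrum of a real symmetric matrix is the multiset of its eigenvalues, counted with multiplicity. **Theorem.** Let $G$ be a connected graph on $n \ge 2$ vertices and let $H$ be a blowup of $G$ with $m$ vertices. Let $\sigma$ be a multiset of $n$ pairwise distinct real numbers and let $\sigma'$ be any multiset of $m - n$ real numbers. Then there is a matrix $A \in \mathcal{S}(H)$ whose spectrum is the multiset union $\sigma \cup \sigma'$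 (multiplicities are added). -/

import Mathlib

/-- `symmMatrices G` is the set `S(G)` of all real symmetric matrices, with rows and columns indexed
by the vertices of `G`, whose off-diagonal entry at `(i, j)` is nonzero exactly when `i` and `j` are
adjacent in `G`. The diagonal entries are unrestricted. -/
def symmMatrices {V : Type*} (G : SimpleGraph V) : Set (Matrix V V ℝ) :=
  {A | A.IsSymm ∧ ∀ i j, i ≠ j → (A i j ≠ 0 ↔ G.Adj i j)}

/-- The spectrum of a real square matrix as a multiset: the real roots of its characteristic
polynomial, with multiplicity. For a symmetric matrix of order `n` it has exactly `n` elements. -/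
noncomputable def spec {V : Type*} [Fintype V] [DecidableEq V] (A : Matrix V V ℝ) : Multiset ℝ :=
  A.charpoly.roots

/-- The closed blowup of `G` with multiplicities `k`: each vertex `v` is replaced by the `k v`
mutually adjacent vertices `⟨v, a⟩`, `a : Fin (k v)`, and every copy of `v` is adjacent to every copy
of each neighbour of `v`, and to nothing else. -/
def closedBlowup {V : Type*} (G : SimpleGraph V) (k : V → ℕ) :
    SimpleGraph (Σ v, Fin (k v)) where
  Adj x y := x ≠ y ∧ (x.1 = y.1 ∨ G.Adj x.1 y.1)
  symm := ⟨fun _ _ h => ⟨h.1.symm, h.2.imp Eq.symm (fun h' => SimpleGraph.Adj.symm h')⟩⟩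
  loopless := ⟨fun _ h => h.1 rfl⟩

/-- `H` is a blowup of `G`: up to isomorphism, it is the closed blowup of `G` with respect to some
positive multiplicities. -/
def IsBlowup {V W : Type*} (G : SimpleGraph V) (H : SimpleGraph W) : Prop :=
  ∃ k : V → ℕ, (∀ v, 0 < k v) ∧ Nonempty (H ≃g closedBlowup G k)

/-!
The proof has two parts.

*A matrix for `G` with controlled diagonal.* Let the values of `σ` be placed on the vertices of `G`,
and consider `A = diag (σ v + t² x v) + t B`, where `B` is a weighted adjacency matrix of `G`. All
the `σ i` are eigenvalues of `A` when `det (σ i - A) = 0` for every `i`. After division by `t²` these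
determinants are polynomials in `x` and `t`, and at `t = 0` the `i`-th one is
`b i * (-∑ j, B i j ^ 2 / (σ i - σ j) - x i)` with `b i ≠ 0` (`exists_det_rescaledMatrix_zero_eq`).
By the inverse function theorem the equations are solvable for all small `t`, with `x` close to the
solution at `t = 0` (`eventually_exists_det_rescaledMatrix_eq_zero`). Since no vertex is isolated,
generic weights make every coordinate of that solution nonzero, so the diagonal entry at `v` is
close to `σ v` but different from it. Hence the diagonal of `A` can avoid any finite set, in
particular the values of `σ'` (`exists_mem_symmMatrices_spec_eq_diag_notMem`).

*Passing to the blowup.* Place `A` on one vertex of each clique of `H` and the values of `σ'` on the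
diagonal at the other vertices. This block diagonal matrix has spectrum `σ + σ'`
(`exists_spec_diagonal_add_eq`). Conjugate it by a generic Householder reflection in each clique.
Between distinct cliques the entries of `A` get multiplied by nonzero factors, and inside a clique
all the off-diagonal entries become nonzero, because the diagonal was not constant there: the
diagonal entry of `A` is not in `σ'` (`exists_mem_symmMatrices_spec_eq_add`).
-/

/-! ### Generic vectors -/

/-- A generic vector `w`, none of whose coordinates vanish, is isotropic for none of finitely many
nonzero diagonal quadratic forms. Every genericity choice below is an instance of this. -/
theorem exists_sum_mul_sq_ne_zero {ι κ : Type*} [Finite ι] [Fintype κ] (c : ι → κ → ℝ)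
    (hc : ∀ i, c i ≠ 0) :
    ∃ w : κ → ℝ, (∀ z, w z ≠ 0) ∧ ∀ i, ∑ z, c i z * w z ^ 2 ≠ 0 := by
  classical
  have := Fintype.ofFinite ι
  let p : ι → MvPolynomial κ ℝ := fun i => ∑ z, MvPolynomial.C (c i z) * MvPolynomial.X z ^ 2
  have hp : ∀ i, p i ≠ 0 := by
    intro i hi
    obtain ⟨z, hz⟩ := Function.ne_iff.1 (hc i)
    have := congrArg (MvPolynomial.eval (Pi.single z (1 : ℝ))) hi
    simp [p, Pi.single_apply] at this
    exact hz this
  have hne : (∏ z : κ, (MvPolynomial.X z : MvPolynomial κ ℝ)) * ∏ i, p i ≠ 0 :=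
    mul_ne_zero (Finset.prod_ne_zero_iff.2 fun z _ => MvPolynomial.X_ne_zero z)
      (Finset.prod_ne_zero_iff.2 fun i _ => hp i)
  obtain ⟨w, hw⟩ : ∃ w, MvPolynomial.eval w
      ((∏ z : κ, (MvPolynomial.X z : MvPolynomial κ ℝ)) * ∏ i, p i) ≠ 0 := by
    by_contra! h
    exact hne (MvPolynomial.funext fun w => by simpa using h w)
  rw [map_mul, map_prod, map_prod] at hw
  refine ⟨w, fun z => ?_, fun i => ?_⟩
  · simpa using Finset.prod_ne_zero_iff.1 (left_ne_zero_of_mul hw) z (Finset.mem_univ z)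
  · simpa [p] using Finset.prod_ne_zero_iff.1 (right_ne_zero_of_mul hw) i (Finset.mem_univ i)

/-! ### Matrices of a graph with distinct eigenvalues -/

theorem spec_eq_map_of_det_eq_zero {V : Type*} [Fintype V] [DecidableEq V] (A : Matrix V V ℝ)
    {σ : V → ℝ} (hσ : Function.Injective σ) (h : ∀ i, (Matrix.scalar V (σ i) - A).det = 0) :
    spec A = Finset.univ.val.map σ := by
  symm
  apply Multiset.eq_of_le_of_card_le
  · rw [Multiset.le_iff_subset ((Multiset.nodup_map_iff_of_injective hσ).2 Finset.univ.nodup)]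
    intro a ha
    obtain ⟨i, -, rfl⟩ := Multiset.mem_map.1 ha
    rw [spec, Polynomial.mem_roots A.charpoly_monic.ne_zero, Polynomial.IsRoot, Matrix.eval_charpoly]
    exact h i
  · refine (Polynomial.card_roots' _).trans ?_
    simp

section Perturbation

variable {V : Type*} [DecidableEq V]

/-- Let `A(x, t) = diag (σ v + t² x v) + t B`, where `B` has zero diagonal. This is the matrix
`σ i - A(x, t)` after dividing both its `i`-th row and its `i`-th column by `t`. It makes sense at
`t = 0` as well, where it has entries `-x i` at `(i, i)` and `σ i - σ j` at `(j, j)` for `j ≠ i`,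
and is `-B` in row `i` and in column `i` away from the diagonal. -/
def rescaledMatrix (σ : V → ℝ) (B : Matrix V V ℝ) (i : V) (x : V → ℝ) (t : ℝ) : Matrix V V ℝ :=
  Matrix.of fun j k =>
    (if j = k then (if j = i then -x i else σ i - σ j - t ^ 2 * x j) else 0)
      - (if j = i ∨ k = i then 1 else t) * B j k

theorem contDiff_det_rescaledMatrix [Fintype V] (σ : V → ℝ) (B : Matrix V V ℝ) (i : V) :
    ContDiff ℝ 1 fun p : (V → ℝ) × ℝ => (rescaledMatrix σ B i p.1 p.2).det := by
  have key : ∀ j k, ContDiff ℝ 1 fun p : (V → ℝ) × ℝ => rescaledMatrix σ B i p.1 p.2 j k := by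
    intro j k
    simp only [rescaledMatrix, Matrix.of_apply]
    split_ifs <;> fun_prop
  simp only [Matrix.det_apply]
  exact ContDiff.sum fun τ _ => (contDiff_prod fun j _ => key _ _).const_smul _

theorem det_sub_eq_sq_mul_det_rescaledMatrix [Fintype V] (σ : V → ℝ) (B : Matrix V V ℝ)
    (hB : ∀ v, B v v = 0) (i : V) (x : V → ℝ) (t : ℝ) :
    (Matrix.scalar V (σ i) - (Matrix.diagonal (fun v => σ v + t ^ 2 * x v) + t • B)).det
      = t ^ 2 * (rescaledMatrix σ B i x t).det := by
  have h : Matrix.scalar V (σ i) - (Matrix.diagonal (fun v => σ v + t ^ 2 * x v) + t • B)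
      = Matrix.diagonal (fun j => if j = i then t else 1) * rescaledMatrix σ B i x t *
        Matrix.diagonal (fun j => if j = i then t else 1) := by
    ext j k
    rw [Matrix.mul_diagonal, Matrix.diagonal_mul]
    by_cases hjk : j = k
    · subst hjk
      by_cases hj : j = i
      · subst hj
        simp [rescaledMatrix, hB]
        ring
      · simp [rescaledMatrix, hB, hj]
        ring
    · by_cases hj : j = i <;> by_cases hk : k = i <;>
        simp_all [rescaledMatrix, Matrix.diagonal_apply_ne, mul_comm]
  rw [h, Matrix.det_mul, Matrix.det_mul, Matrix.det_diagonal]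
  simp
  ring

/-- At `t = 0` the determinant of the rescaled matrix depends on `x i` only; it is an affine
function with nonzero slope, whose zero is the second-order term of the perturbation series of the
eigenvalue `σ i`, with the opposite sign. -/
theorem exists_det_rescaledMatrix_zero_eq [Fintype V] {σ : V → ℝ} (hσ : Function.Injective σ)
    {B : Matrix V V ℝ} (hs : B.IsSymm) (hB : ∀ v, B v v = 0) (i : V) :
    ∃ b : ℝ, b ≠ 0 ∧ ∀ x : V → ℝ, (rescaledMatrix σ B i x 0).det
      = (-(∑ j, B i j ^ 2 / (σ i - σ j)) - x i) * b := by
  set c : V → ℝ := fun i => -(∑ j, B i j ^ 2 / (σ i - σ j)) with hc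
  have hsymm : ∀ j k, B j k = B k j := fun j k => hs.apply k j
  have hne : ∀ j, j ≠ i → σ i - σ j ≠ 0 := fun j hj => sub_ne_zero.2 fun h => hj (hσ h).symm
  set M := rescaledMatrix σ B i c 0 with hM
  refine ⟨(M.updateRow i (Pi.single i 1)).det, ?_, fun x => ?_⟩
  -- Replacing row `i` by a unit vector leaves a matrix with trivial kernel.
  · intro h0
    obtain ⟨y, hy, hy0⟩ := Matrix.exists_mulVec_eq_zero_iff.2 h0
    have hyi : y i = 0 := by
      have := congrFun hy0 i
      simpa [Matrix.mulVec, Matrix.updateRow_self] using this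
    refine hy (funext fun j => ?_)
    by_cases hj : j = i
    · rw [hj, hyi]; rfl
    have := congrFun hy0 j
    rw [Matrix.mulVec, Matrix.updateRow_ne hj, dotProduct, Finset.sum_eq_single j] at this
    · simp [M, rescaledMatrix, hj] at this
      exact this.resolve_left (hne j hj)
    · intro k _ hk
      by_cases hki : k = i
      · rw [hki, hyi, mul_zero]
      · simp [M, rescaledMatrix, hj, hki, hk.symm]
    · simp
  -- At the claimed zero `c` an explicit kernel vector is available.
  · have hdet : M.det = 0 := by
      refine Matrix.exists_mulVec_eq_zero_iff.1
        ⟨fun j => if j = i then 1 else B i j / (σ i - σ j), fun h => ?_, ?_⟩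
      · simpa using congrFun h i
      · ext j
        by_cases hj : j = i
        · subst hj
          have : ∀ k, M j k * (if k = j then 1 else B j k / (σ j - σ k))
              = (if k = j then c j else 0) * (-1) - B j k ^ 2 / (σ j - σ k) := by
            intro k
            by_cases hk : k = j
            · subst hk
              simp [M, rescaledMatrix, hB]
            · simp [M, rescaledMatrix, hk, Ne.symm hk]
              ring
          simp only [Matrix.mulVec, dotProduct, this, Finset.sum_sub_distrib, ← Finset.sum_mul]
          simp [hc]
        · have : ∀ k, M j k * (if k = i then 1 else B i k / (σ i - σ k))
              = (if k = i then -B j i else 0) + (if k = j then B j i else 0) := by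
            intro k
            by_cases hk : k = i
            · subst hk
              simp [M, rescaledMatrix, hj, Ne.symm hj]
            · by_cases hkj : k = j
              · subst hkj
                simp [M, rescaledMatrix, hk, hsymm k i]
                field_simp [hne k hk]
              · simp [M, rescaledMatrix, hk, hj, hkj, Ne.symm hkj]
          simp only [Matrix.mulVec, dotProduct, this, Finset.sum_add_distrib]
          simp
    have hrow : rescaledMatrix σ B i x 0
        = M.updateRow i (M i + (c i - x i) • Pi.single i 1) := by
      ext j k
      by_cases hj : j = i
      · subst hj
        by_cases hk : k = j
        · subst hk
          simp [M, rescaledMatrix, hB]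
          ring
        · simp [M, rescaledMatrix, hk, Ne.symm hk]
      · rw [Matrix.updateRow_ne hj]
        simp [M, rescaledMatrix, hj]
    rw [hrow, Matrix.det_updateRow_add, Matrix.det_updateRow_smul, Matrix.updateRow_eq_self, hdet,
      zero_add]

open Filter Topology in
/-- For all small `t` the eigenvalue equations of every `σ i` have a common solution `x`, and it can
be taken close to the solution at `t = 0`: the map `(x, t) ↦ ((det (rescaledMatrix σ B i x t))ᵢ, t)`
has surjective derivative there, so it maps neighbourhoods to neighbourhoods. -/
theorem eventually_exists_det_rescaledMatrix_eq_zero [Fintype V] {σ : V → ℝ}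
    (hσ : Function.Injective σ) {B : Matrix V V ℝ} (hs : B.IsSymm) (hB : ∀ v, B v v = 0)
    {U : Set ((V → ℝ) × ℝ)} (hU : U ∈ 𝓝 ((fun i => -(∑ j, B i j ^ 2 / (σ i - σ j))), (0 : ℝ))) :
    ∀ᶠ t in 𝓝 (0 : ℝ), ∃ x, (x, t) ∈ U ∧ ∀ i, (rescaledMatrix σ B i x t).det = 0 := by
  set c : V → ℝ := fun i => -(∑ j, B i j ^ 2 / (σ i - σ j)) with hc
  choose b hb hdet using exists_det_rescaledMatrix_zero_eq hσ hs hB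
  let Ψ : (V → ℝ) × ℝ → V → ℝ := fun p i => (rescaledMatrix σ B i p.1 p.2).det
  have hΨ : ContDiff ℝ 1 Ψ := contDiff_pi.2 fun i => contDiff_det_rescaledMatrix σ B i
  have hD : HasStrictFDerivAt Ψ (fderiv ℝ Ψ (c, 0)) (c, 0) :=
    hΨ.contDiffAt.hasStrictFDerivAt one_ne_zero
  set D := fderiv ℝ Ψ (c, 0)
  have hf := hD.prodMk (hasStrictFDerivAt_snd (𝕜 := ℝ) (p := ((c, 0) : (V → ℝ) × ℝ)))
  have hD0 : ∀ ξ : V → ℝ, D (ξ, 0) = fun i => -ξ i * b i := by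
    have h1 : HasFDerivAt (fun x : V → ℝ => Ψ (x, 0)) (D.comp (ContinuousLinearMap.inl ℝ _ ℝ)) c :=
      HasFDerivAt.comp (f := fun x : V → ℝ => (x, (0 : ℝ))) c hD.hasFDerivAt
        (hasFDerivAt_prodMk_left c 0)
    intro ξ
    ext i
    have h2 := hasFDerivAt_pi'.1 h1 i
    have h3 : HasFDerivAt (fun x : V → ℝ => (c i - x i) * b i)
        (b i • -(ContinuousLinearMap.proj (R := ℝ) (φ := fun _ : V => ℝ) i)) c :=
      ((hasFDerivAt_apply i c).const_sub (c i)).mul_const (b i)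
    have h4 : (fun x : V → ℝ => Ψ (x, 0) i) = fun x => (c i - x i) * b i :=
      funext fun x => hdet i x
    rw [h4] at h2
    have := congrArg (fun T => T ξ) (h2.unique h3)
    simpa [mul_comm] using this
  have hsurj : (D.prod (ContinuousLinearMap.snd ℝ (V → ℝ) ℝ)).range = ⊤ := by
    refine LinearMap.range_eq_top.2 ?_
    rintro ⟨η, τ⟩
    refine ⟨(fun i => -(η i - D (0, τ) i) / b i, 0) + (0, τ), ?_⟩
    simp only [ContinuousLinearMap.coe_coe, ContinuousLinearMap.prod_apply, map_add, hD0]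
    ext i
    · simp [hb i]
    · simp
  have hmap := hf.map_nhds_eq_of_surj hsurj
  have hΨ0 : Ψ (c, 0) = 0 := funext fun i => by simp [Ψ, hdet, hc]
  have himg := image_mem_map (m := fun p : (V → ℝ) × ℝ => (Ψ p, p.2)) hU
  rw [hmap, hΨ0] at himg
  have hcont : Tendsto (fun t : ℝ => ((0 : V → ℝ), t)) (𝓝 0) (𝓝 (0, 0)) :=
    (Continuous.prodMk_right (0 : V → ℝ)).tendsto 0
  filter_upwards [hcont himg] with t ht
  obtain ⟨⟨x, s⟩, hxU, hx⟩ := ht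
  obtain ⟨hx1, rfl⟩ := Prod.ext_iff.1 hx
  exact ⟨x, hxU, fun i => congrFun hx1 i⟩

open Filter Topology in
/-- A graph without isolated vertices has a matrix with any prescribed distinct eigenvalues whose
diagonal avoids any prescribed finite set. -/
theorem exists_mem_symmMatrices_spec_eq_diag_notMem [Fintype V] (G : SimpleGraph V)
    (hG : ∀ v, ∃ u, G.Adj v u) {σ : V → ℝ} (hσ : Function.Injective σ) (F : Finset ℝ) :
    ∃ A ∈ symmMatrices G, spec A = Finset.univ.val.map σ ∧ ∀ v, A v v ∉ F := by
  classical
  obtain ⟨w, hw, hw'⟩ := exists_sum_mul_sq_ne_zero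
    (fun v u => if G.Adj v u then (σ v - σ u)⁻¹ else 0) (by
      intro v h
      obtain ⟨u, hu⟩ := hG v
      have := congrFun h u
      simp only [hu, if_true, Pi.zero_apply, inv_eq_zero, sub_eq_zero] at this
      exact hu.ne (hσ this))
  let B : Matrix V V ℝ := Matrix.of fun u v => if G.Adj u v then w u * w v else 0
  have hs : B.IsSymm := by
    ext u v
    simp [B, G.adj_comm u v, mul_comm]
  have hB : ∀ v, B v v = 0 := fun v => by simp [B]
  set c : V → ℝ := fun i => -(∑ j, B i j ^ 2 / (σ i - σ j)) with hc
  -- With the product weights `w u * w v`, `c i` is `w i ^ 2` times a diagonal form in `w`.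
  have hc0 : ∀ i, c i ≠ 0 := by
    intro i
    have : c i = -(w i ^ 2 * ∑ u, (if G.Adj i u then (σ i - σ u)⁻¹ else 0) * w u ^ 2) := by
      simp only [hc, Finset.mul_sum]
      congr 1
      refine Finset.sum_congr rfl fun u _ => ?_
      by_cases h : G.Adj i u
      · simp [B, h]; ring
      · simp [B, h]
    rw [this]
    exact neg_ne_zero.2 (mul_ne_zero (pow_ne_zero _ (hw i)) (hw' i))
  have hx : ∀ᶠ p : (V → ℝ) × ℝ in 𝓝 (c, 0), ∀ i, p.1 i ≠ 0 := by
    rw [eventually_all]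
    intro i
    have : Continuous fun p : (V → ℝ) × ℝ => p.1 i := by fun_prop
    exact this.continuousAt.eventually_ne (hc0 i)
  -- Values of `F` other than `σ i` are avoided by closeness to `σ i`, and `σ i` itself because
  -- the second-order term does not vanish.
  have hF : ∀ᶠ p : (V → ℝ) × ℝ in 𝓝 (c, 0), ∀ i, σ i + p.2 ^ 2 * p.1 i ∉ F.erase (σ i) := by
    rw [eventually_all]
    intro i
    have hcont : Continuous fun p : (V → ℝ) × ℝ => σ i + p.2 ^ 2 * p.1 i := by fun_prop
    refine hcont.continuousAt.eventually_mem
      ((F.erase (σ i)).finite_toSet.isClosed.isOpen_compl.mem_nhds ?_)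
    simp
  have hev := eventually_exists_det_rescaledMatrix_eq_zero hσ hs hB (hx.and hF)
  obtain ⟨t, ⟨x, ⟨hx0, hxF⟩, hdet⟩, ht⟩ :=
    ((hev.filter_mono nhdsWithin_le_nhds).and (self_mem_nhdsWithin (s := {(0 : ℝ)}ᶜ))).exists
  have ht : t ≠ 0 := ht
  refine ⟨Matrix.diagonal (fun v => σ v + t ^ 2 * x v) + t • B, ⟨?_, ?_⟩, ?_, ?_⟩
  · exact (Matrix.isSymm_diagonal _).add (hs.smul t)
  · intro i j hij
    by_cases h : G.Adj i j <;> simp [Matrix.diagonal_apply_ne _ hij, B, h, ht, hw]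
  · refine spec_eq_map_of_det_eq_zero _ hσ fun i => ?_
    rw [det_sub_eq_sq_mul_det_rescaledMatrix σ B hB, hdet, mul_zero]
  · intro v hv
    refine hxF v (Finset.mem_erase.2 ⟨?_, ?_⟩)
    · simp [ht, hx0 v]
    · simpa [hB] using hv

end Perturbation

/-! ### Reflections in the fibers of a map -/

section Reflection

variable {V W : Type*} [DecidableEq V] [Fintype W]

/-- The squared Euclidean norm of the restriction of `w` to the fiber of `π` over `v`. -/
noncomputable def fiberNormSq (π : W → V) (w : W → ℝ) (v : V) : ℝ :=
  ∑ z, if π z = v then w z ^ 2 else 0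

/-- The block diagonal matrix, with one block for each fiber of `π`, whose blocks are the Householder
reflections along the restrictions of `w` to the fibers. -/
noncomputable def fiberReflection [DecidableEq W] (π : W → V) (w : W → ℝ) : Matrix W W ℝ :=
  1 - Matrix.of fun x y => if π x = π y then 2 * w x * w y / fiberNormSq π w (π x) else 0

theorem fiberNormSq_pos (π : W → V) {w : W → ℝ} (hw : ∀ z, w z ≠ 0) (x : W) :
    0 < fiberNormSq π w (π x) := by
  have h : w x ^ 2 ≤ fiberNormSq π w (π x) := by
    have := Finset.single_le_sum (f := fun z => if π z = π x then w z ^ 2 else 0)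
      (fun z _ => by positivity) (Finset.mem_univ x)
    simpa [fiberNormSq] using this
  exact (pow_pos (abs_pos.2 (hw x)) 2).trans_le (by simpa using h)

variable [DecidableEq W]

theorem isSymm_fiberReflection (π : W → V) (w : W → ℝ) : (fiberReflection π w).IsSymm := by
  refine Matrix.isSymm_one.sub (Matrix.IsSymm.ext fun x y => ?_)
  by_cases h : π x = π y
  · simp [h, mul_right_comm]
  · simp [h, Ne.symm h]

theorem fiberReflection_mul_diagonal_mul_apply (π : W → V) (w d : W → ℝ) (x y : W) :
    (fiberReflection π w * Matrix.diagonal d * fiberReflection π w) x y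
      = (if x = y then d x else 0) + if π x = π y then
        2 * w x * w y / fiberNormSq π w (π x) *
          (2 * (∑ z, if π z = π x then d z * w z ^ 2 else 0) / fiberNormSq π w (π x) - d x - d y)
        else 0 := by
  set N := fiberNormSq π w (π x) with hN
  set K : Matrix W W ℝ :=
    Matrix.of fun x y => if π x = π y then 2 * w x * w y / fiberNormSq π w (π x) else 0 with hK
  have hexp : fiberReflection π w * Matrix.diagonal d * fiberReflection π w
      = Matrix.diagonal d - K * Matrix.diagonal d - Matrix.diagonal d * K
        + K * Matrix.diagonal d * K := by
    rw [fiberReflection, ← hK]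
    noncomm_ring
  have hKDK : (K * Matrix.diagonal d * K) x y = if π x = π y then
      2 * w x * w y / N * (2 * (∑ z, if π z = π x then d z * w z ^ 2 else 0) / N) else 0 := by
    rw [Matrix.mul_apply]
    by_cases h : π x = π y
    · rw [if_pos h, Finset.mul_sum, Finset.sum_div, Finset.mul_sum]
      refine Finset.sum_congr rfl fun z _ => ?_
      by_cases hz : π z = π x
      · simp only [Matrix.mul_diagonal, hK, Matrix.of_apply, hz, h, if_true, hN]
        ring
      · simp [hK, hz, Ne.symm hz]
    · rw [if_neg h]
      refine Finset.sum_eq_zero fun z _ => ?_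
      by_cases hz : π x = π z
      · have : π z ≠ π y := fun h' => h (hz.trans h')
        simp [hK, this]
      · simp [hK, hz]
  rw [hexp, Matrix.add_apply, Matrix.sub_apply, Matrix.sub_apply, hKDK, Matrix.mul_diagonal,
    Matrix.diagonal_mul, Matrix.diagonal_apply]
  by_cases h : π x = π y
  · simp only [hK, Matrix.of_apply, h, if_true, hN]
    ring
  · simp [hK, h]

theorem fiberReflection_mul_self (π : W → V) {w : W → ℝ} (hw : ∀ z, w z ≠ 0) :
    fiberReflection π w * fiberReflection π w = 1 := by
  ext x y
  have h := fiberReflection_mul_diagonal_mul_apply π w (fun _ => 1) x y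
  rw [Matrix.diagonal_one, Matrix.mul_one] at h
  have hN := (fiberNormSq_pos π hw x).ne'
  have hsum : (∑ z, if π z = π x then 1 * w z ^ 2 else 0) = fiberNormSq π w (π x) := by
    simp [fiberNormSq]
  rw [h, hsum, mul_div_assoc 2 (fiberNormSq π w (π x)), div_self hN, Matrix.one_apply]
  norm_num

end Reflection

/-! ### Matrices of a blowup -/

section Blowup

variable {V W : Type*} [Fintype V] [DecidableEq V] [Fintype W] [DecidableEq W]

theorem exists_map_univ_eq {ι α : Type*} [Fintype ι] (s : Multiset α)
    (h : s.card = Fintype.card ι) : ∃ f : ι → α, Finset.univ.val.map f = s := by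
  obtain ⟨l, rfl⟩ := Quot.exists_rep s
  let e : ι ≃ Fin l.length := Fintype.equivFinOfCardEq h.symm
  refine ⟨fun i => l.get (e i), ?_⟩
  have h1 : Finset.univ.val.map e = (Finset.univ : Finset (Fin l.length)).val := by
    rw [← Finset.map_univ_equiv e]; rfl
  calc Finset.univ.val.map (fun i => l.get (e i))
      = (Finset.univ.val.map e).map l.get := by rw [Multiset.map_map]; rfl
    _ = l := by
      rw [h1, Fin.univ_val_map, List.ofFn_get]

/-- The matrix `A`, transported along `s : V → W`, can be completed to a block diagonal matrix on `W`
by a diagonal matrix outside the range of `s`, so as to add `σ'` to the spectrum. The result is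
written as its diagonal `d` plus the transport of the off-diagonal part of `A`. -/
theorem exists_spec_diagonal_add_eq (A : Matrix V V ℝ) {s : V → W} (hs : Function.Injective s)
    (σ' : Multiset ℝ) (hcard : σ'.card + Fintype.card V = Fintype.card W) :
    ∃ d : W → ℝ, (∀ v, d (s v) = A v v) ∧ (∀ x, x ∉ Set.range s → d x ∈ σ') ∧
      spec (Matrix.diagonal d + (1 : Matrix W W ℝ).submatrix id s *
        (A - Matrix.diagonal fun v => A v v) * (1 : Matrix W W ℝ).submatrix s id)
        = spec A + σ' := by
  classical
  let e : V ⊕ {x // x ∉ Set.range s} ≃ W :=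
    ((Equiv.ofInjective s hs).sumCongr (Equiv.refl _)).trans (Equiv.sumCompl (· ∈ Set.range s))
  have hel : ∀ v, e (Sum.inl v) = s v := fun v => rfl
  have her : ∀ r, e (Sum.inr r) = r.1 := fun r => rfl
  obtain ⟨l, hl⟩ := exists_map_univ_eq (ι := {x // x ∉ Set.range s}) σ' (by
    have := Fintype.card_congr e
    rw [Fintype.card_sum] at this
    omega)
  let d : W → ℝ := fun x => Sum.elim (fun v => A v v) l (e.symm x)
  have hdl : ∀ v, d (s v) = A v v := fun v => by simp [d, ← hel]
  have hdr : ∀ r : {x // x ∉ Set.range s}, d r.1 = l r := fun r => by simp [d, ← her]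
  refine ⟨d, hdl, fun x hx => ?_, ?_⟩
  · rw [hdr ⟨x, hx⟩, ← hl]
    exact Multiset.mem_map_of_mem _ (Finset.mem_univ_val _)
  · have hP : (1 : Matrix W W ℝ).submatrix e s = Matrix.fromRows 1 0 := by
      ext (v | r) u
      · simp [hel, Matrix.one_apply, hs.eq_iff]
      · have : r.1 ≠ s u := fun h => r.2 ⟨u, h.symm⟩
        simp [her, this]
    have hP' : (1 : Matrix W W ℝ).submatrix s e = Matrix.fromCols 1 0 := by
      ext u (v | r)
      · simp [hel, Matrix.one_apply, hs.eq_iff]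
      · have : s u ≠ r.1 := fun h => r.2 ⟨u, h⟩
        simp [her, this]
    have hblock : Matrix.reindex e.symm e.symm (Matrix.diagonal d +
        (1 : Matrix W W ℝ).submatrix id s * (A - Matrix.diagonal fun v => A v v) *
          (1 : Matrix W W ℝ).submatrix s id) = Matrix.fromBlocks A 0 0 (Matrix.diagonal l) := by
      have h1 : Matrix.reindex e.symm e.symm ((1 : Matrix W W ℝ).submatrix id s *
          (A - Matrix.diagonal fun v => A v v) * (1 : Matrix W W ℝ).submatrix s id)
          = (1 : Matrix W W ℝ).submatrix e s * (A - Matrix.diagonal fun v => A v v) *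
            (1 : Matrix W W ℝ).submatrix s e := rfl
      have h2 : Matrix.reindex e.symm e.symm (Matrix.diagonal d)
          = Matrix.fromBlocks (Matrix.diagonal fun v => A v v) 0 0 (Matrix.diagonal l) := by
        rw [Matrix.fromBlocks_diagonal, Matrix.reindex_apply, Equiv.symm_symm,
          Matrix.submatrix_diagonal_equiv]
        congr 1
        ext (v | r)
        · exact hdl v
        · exact hdr r
      have hadd : ∀ X Y : Matrix W W ℝ, Matrix.reindex e.symm e.symm (X + Y)
          = Matrix.reindex e.symm e.symm X + Matrix.reindex e.symm e.symm Y := fun _ _ => rfl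
      rw [hadd, h1, h2, hP, hP', Matrix.fromRows_mul, Matrix.fromRows_mul_fromCols]
      simp [-Matrix.fromBlocks_diagonal, Matrix.fromBlocks_add]
    rw [spec, ← Matrix.charpoly_reindex e.symm, hblock, Matrix.charpoly_fromBlocks_zero₁₂,
      Polynomial.roots_mul (mul_ne_zero (Matrix.charpoly_monic _).ne_zero
        (Matrix.charpoly_monic _).ne_zero), Matrix.charpoly_diagonal, ← hl, spec]
    congr 1
    rw [← Polynomial.roots_multiset_prod_X_sub_C (Finset.univ.val.map l), Multiset.map_map]
    rfl

/-- Here `H` is presented as the closed blowup of `G` whose cliques are the fibers of `π`, and `s`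
chooses one vertex in each of them. -/
theorem exists_mem_symmMatrices_spec_eq_add {G : SimpleGraph V} {H : SimpleGraph W} {π : W → V}
    {s : V → W} (hs : ∀ v, π (s v) = v)
    (hH : ∀ x y, H.Adj x y ↔ x ≠ y ∧ (π x = π y ∨ G.Adj (π x) (π y)))
    {A : Matrix V V ℝ} (hA : A ∈ symmMatrices G) (σ' : Multiset ℝ)
    (hcard : σ'.card + Fintype.card V = Fintype.card W) (hdiag : ∀ v, A v v ∉ σ') :
    ∃ A' ∈ symmMatrices H, spec A' = spec A + σ' := by
  obtain ⟨d, hds, hdr, hspec⟩ := exists_spec_diagonal_add_eq A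
    (Function.LeftInverse.injective hs) σ' hcard
  set A₀ : Matrix V V ℝ := A - Matrix.diagonal fun v => A v v with hA₀
  have hA₀symm : A₀.IsSymm := hA.1.sub (Matrix.isSymm_diagonal _)
  have hdne : ∀ x, x ≠ s (π x) → d x ≠ d (s (π x)) := by
    intro x hx h
    rw [hds] at h
    refine hdiag (π x) (h ▸ hdr x ?_)
    rintro ⟨v, rfl⟩
    exact hx (by rw [hs])
  -- The first family of forms makes the entries of the reflection at the points `s v` nonzero, the
  -- second one the entries of the conjugated diagonal matrix between two vertices of one fiber.
  obtain ⟨w, hw, hw'⟩ := exists_sum_mul_sq_ne_zero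
    (Sum.elim
      (fun v z => if π z = v then (if z = s v then -1 else 1) else 0)
      (fun (p : {p : W × W // p.1 ≠ p.2 ∧ π p.1 = π p.2}) z =>
        if π z = π p.1.1 then 2 * d z - d p.1.1 - d p.1.2 else 0)) (by
      rintro (v | ⟨⟨x, y⟩, hxy, hπ⟩) h
      · simpa [hs] using congrFun h (s v)
      · dsimp only at hxy hπ
        have hz : ∀ z, π z = π x → 2 * d z - d x - d y = 0 := fun z hz => by
          simpa [hz] using congrFun h z
        have hx := hz x rfl
        have hy := hz y hπ.symm
        have h0 := hz (s (π x)) (hs _)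
        -- Vanishing of the form would make `d` constant on the fiber.
        by_cases hxs : x = s (π x)
        · refine hdne y (fun hys => hxy ?_) ?_
          · rw [hxs, hys, hπ]
          · rw [← hπ]; linarith
        · exact hdne x hxs (by linarith))
  have hsign := fun v => hw' (Sum.inl v)
  have hpair := fun x y (hxy : x ≠ y) (hπ : π x = π y) => hw' (Sum.inr ⟨(x, y), hxy, hπ⟩)
  simp only [Sum.elim_inl, Sum.elim_inr] at hsign hpair
  simp only [ite_mul, zero_mul] at hpair
  set Q := fiberReflection π w with hQ
  have hN := fun x => (fiberNormSq_pos π hw x).ne'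
  have hQs : ∀ x, Q x (s (π x)) ≠ 0 := by
    intro x
    by_cases hx : x = s (π x)
    · have hsum : (∑ z, (if π z = π x then (if z = s (π x) then -1 else 1) else 0) * w z ^ 2)
          = fiberNormSq π w (π x) - 2 * w x ^ 2 := by
        have : ∀ z, (if π z = π x then (if z = s (π x) then -1 else 1) else 0) * w z ^ 2
            = (if π z = π x then w z ^ 2 else 0) - if z = x then 2 * w x ^ 2 else 0 := by
          intro z
          rw [← hx]
          by_cases hz : z = x
          -- On the base point the form has coefficient `-1 = 1 - 2`.
          · subst hz; simp; ring
          · simp [hz]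
        simp only [this, Finset.sum_sub_distrib]
        simp [fiberNormSq]
      have h := hsign (π x)
      rw [hsum] at h
      rw [← hx]
      simp only [hQ, fiberReflection, Matrix.sub_apply, Matrix.one_apply_eq, Matrix.of_apply,
        if_true]
      intro h'
      have := hN x
      field_simp at h'
      exact h (by linarith)
    · simp [hQ, fiberReflection, Matrix.one_apply_ne hx, hs, hw, hN x]
  have hQ0 : ∀ x v, π x ≠ v → Q x (s v) = 0 := by
    intro x v h
    have hx : x ≠ s v := fun hx => h (by rw [hx, hs])
    simp [hQ, fiberReflection, Matrix.one_apply_ne hx, hs, h]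
  have hQsymm : ∀ x y, Q x y = Q y x := fun x y => (isSymm_fiberReflection π w).apply y x
  have hoff : ∀ x y, (Q.submatrix id s * A₀ * Q.submatrix s id) x y
      = Q x (s (π x)) * A₀ (π x) (π y) * Q y (s (π y)) := by
    intro x y
    rw [Matrix.mul_apply, Finset.sum_eq_single (π y), Matrix.mul_apply,
      Finset.sum_eq_single (π x)]
    · simp [hQsymm y]
    · intro v _ hv
      simp [hQ0 x v hv.symm]
    · simp
    · intro v _ hv
      simp [hQsymm _ y, hQ0 y v hv.symm]
    · simp
  set B := Matrix.diagonal d + (1 : Matrix W W ℝ).submatrix id s * A₀ *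
    (1 : Matrix W W ℝ).submatrix s id with hB
  have hQBQ : Q * B * Q
      = Q * Matrix.diagonal d * Q + Q.submatrix id s * A₀ * Q.submatrix s id := by
    have h1 : Q * (1 : Matrix W W ℝ).submatrix id s = Q.submatrix id s := by
      ext x v
      simp [Matrix.mul_apply, Matrix.one_apply]
    have h2 : (1 : Matrix W W ℝ).submatrix s id * Q = Q.submatrix s id := by
      ext v x
      simp [Matrix.mul_apply, Matrix.one_apply]
    rw [hB, Matrix.mul_add, Matrix.add_mul, ← h1, ← h2]
    simp only [Matrix.mul_assoc]
  refine ⟨Q * B * Q, ⟨?_, ?_⟩, ?_⟩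
  · rw [hQBQ]
    refine Matrix.IsSymm.ext fun x y => ?_
    rw [Matrix.add_apply, Matrix.add_apply, hoff, hoff, hA₀symm.apply]
    have : (Q * Matrix.diagonal d * Q).IsSymm := by
      rw [Matrix.IsSymm, Matrix.transpose_mul, Matrix.transpose_mul,
        isSymm_fiberReflection, Matrix.diagonal_transpose, Matrix.mul_assoc]
    rw [this.apply]
    ring
  · intro x y hxy
    rw [hQBQ, Matrix.add_apply, hoff, hQ, fiberReflection_mul_diagonal_mul_apply, ← hQ,
      if_neg hxy, zero_add, hH]
    by_cases hπ : π x = π y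
    · have hA₀0 : A₀ (π x) (π y) = 0 := by simp [hA₀, hπ]
      have hsum : (∑ z, if π z = π x then (2 * d z - d x - d y) * w z ^ 2 else 0)
          = 2 * (∑ z, if π z = π x then d z * w z ^ 2 else 0)
            - (d x + d y) * fiberNormSq π w (π x) := by
        rw [fiberNormSq, Finset.mul_sum, Finset.mul_sum, ← Finset.sum_sub_distrib]
        refine Finset.sum_congr rfl fun z _ => ?_
        split_ifs <;> ring
      have h := hpair x y hxy hπ
      rw [hsum] at h
      rw [if_pos hπ, hA₀0, mul_zero, zero_mul, add_zero]
      refine iff_of_true (mul_ne_zero (div_ne_zero (by simp [hw]) (hN x)) fun h' => h ?_)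
        ⟨hxy, Or.inl hπ⟩
      have := hN x
      field_simp at h'
      linarith
    · have hA₀A : A₀ (π x) (π y) = A (π x) (π y) := by simp [hA₀, hπ]
      rw [if_neg hπ, zero_add, hA₀A]
      simp [hQs, hxy, hπ, ← hA.2 _ _ hπ]
  · rw [← hspec, spec, spec, Matrix.mul_assoc, Matrix.charpoly_mul_comm, Matrix.mul_assoc,
      fiberReflection_mul_self π hw, Matrix.mul_one]

end Blowup

theorem theorem2p4 {V W : Type*} [Fintype V] [Fintype W] [DecidableEq W]
    (G : SimpleGraph V) (H : SimpleGraph W) (n m : ℕ)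
    (hV : Fintype.card V = n) (hn : 2 ≤ n) (hG : G.Connected)
    (hW : Fintype.card W = m) (hH : IsBlowup G H)
    (σ σ' : Multiset ℝ) (hσ : σ.card = n) (hσ_distinct : σ.Nodup)
    (hσ' : σ'.card = m - n) :
    ∃ A ∈ symmMatrices H, spec A = σ + σ' := by
  classical
  obtain ⟨k, hk, ⟨φ⟩⟩ := hH
  let π : W → V := fun x => (φ x).1
  let s : V → W := fun v => φ.symm ⟨v, 0, hk v⟩
  have hs : ∀ v, π (s v) = v := fun v => by simp [π, s]
  have hadj : ∀ x y, H.Adj x y ↔ x ≠ y ∧ (π x = π y ∨ G.Adj (π x) (π y)) := by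
    intro x y
    rw [← φ.map_adj_iff]
    change φ x ≠ φ y ∧ _ ↔ _
    rw [φ.injective.ne_iff]
  have hle : Fintype.card V ≤ Fintype.card W :=
    Fintype.card_le_of_injective s (Function.LeftInverse.injective hs)
  have : Nontrivial V := Fintype.one_lt_card_iff_nontrivial.1 (by omega)
  obtain ⟨f, rfl⟩ := exists_map_univ_eq (ι := V) σ (by omega)
  have hf : Function.Injective f := fun i j h =>
    Multiset.inj_on_of_nodup_map hσ_distinct i (Finset.mem_univ_val i) j (Finset.mem_univ_val j) h
  obtain ⟨A, hA, hspec, hdiag⟩ := exists_mem_symmMatrices_spec_eq_diag_notMem G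
    hG.preconnected.exists_adj_of_nontrivial hf σ'.toFinset
  rw [← hspec]
  exact exists_mem_symmMatrices_spec_eq_add hs hadj hA σ' (by omega)
    fun v hv => hdiag v (Multiset.mem_toFinset.2 hv)
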